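/- Let $K$ be a field, let $n\ge 2$, let $S=K[x_1,\dots,x_n]$ be the standard graded polynomial ring, and let $I\subset S$ be a nonzero squarefree monomial ideal generated in degree $n-2$. Then there is exactly one simple graph $G$ on the vertex set $[n]=\{1,\dots,n\}$ such that $I=I_c(G)$, where $$I_c(G)=\Bigl(\prod_{i\in[n]\setminus e}x_i\ :\ e\in E(G)\Bigr)$$ is the complementary edge ideal of $G$, and for this $G$ the following statements are equivalent. (i) $I$ has a linear resolution. (ii) $I^k$ has a linear resolution, for all $k\ge1$. (iii) $I^k$ has linear quotients, for all $k\ge1$. (iv) $c(G)=1$, where $c(G)$ denotes the number of connected components of $G$ having more than one vertex. Here an ideal $L\subset S$ has a *linear resolution* if, for some $d$, it has a minimal graded free resolution $\cdots\to F_1\to F_0\to L\to 0$ with $F_i\cong S(-d-i)^{b_i}$ for all $i\ge 0$. A monomial ideal $L\subset S$ has *linear quotients* if its minimal monomial generators can be ordered as $u_1,\dots,u_m$ in such a way that the colon ideal $(u_1,\dots,u_{j-1}):(u_j)$ is generated by variables for all $j=2,\dots,m$. -/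

import Mathlib

open MvPolynomial

namespace MonomialIdeal

/-- `I` is generated by monomials. -/
def IsMonomial {n : ℕ} {K : Type*} [Field K] (I : Ideal (MvPolynomial (Fin n) K)) : Prop :=
  ∃ A : Set (Fin n →₀ ℕ), I = Ideal.span ((fun a => monomial a (1 : K)) '' A)

/-- The exponent vectors of the minimal monomial generators of a monomial ideal `I`: the
monomials of `I` which are minimal with respect to divisibility (that is, whose exponent vector is
minimal for the componentwise order). -/
def minGens {n : ℕ} {K : Type*} [Field K] (I : Ideal (MvPolynomial (Fin n) K)) :
    Set (Fin n →₀ ℕ) :=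
  {a | Minimal (fun b : Fin n →₀ ℕ => monomial b (1 : K) ∈ I) a}

/-- `I` is a monomial ideal whose minimal monomial generators are squarefree. -/
def IsSquarefreeMonomial {n : ℕ} {K : Type*} [Field K]
    (I : Ideal (MvPolynomial (Fin n) K)) : Prop :=
  IsMonomial I ∧ ∀ a ∈ minGens I, ∀ i, a i ≤ 1

/-- All the minimal monomial generators of `I` have degree `d`. -/
def IsGeneratedInDegree {n : ℕ} {K : Type*} [Field K]
    (I : Ideal (MvPolynomial (Fin n) K)) (d : ℕ) : Prop :=
  ∀ a ∈ minGens I, a.degree = d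

/-- A monomial ideal `I` has linear quotients if its minimal monomial generators can be ordered as
`u₁, …, uₘ` in such a way that each colon ideal `(u₁, …, u_{j-1}) : (u_j)`, for `j = 2, …, m`, is
generated by a set of variables. (The index `j : Fin m` is shifted by one.) -/
def HasLinearQuotients {n : ℕ} {K : Type*} [Field K]
    (I : Ideal (MvPolynomial (Fin n) K)) : Prop :=
  ∃ (m : ℕ) (u : Fin m → (Fin n →₀ ℕ)),
    Function.Injective u ∧ Set.range u = minGens I ∧
    ∀ j : Fin m, 0 < (j : ℕ) → ∃ V : Set (Fin n),
      (Ideal.span ((fun i => monomial (u i) (1 : K)) '' {i | i < j})).colon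
          (Ideal.span {monomial (u j) (1 : K)} : Set (MvPolynomial (Fin n) K)) =
        Ideal.span ((fun i => (X i : MvPolynomial (Fin n) K)) '' V)

/-- A minimal graded free resolution
`⋯ → F₂ → F₁ → F₀ → I → 0` of an ideal `I` of `S = K[x₁, …, xₙ]`, where
`F i = ⨁_j S(-shift i j)` has rank `rank i`. With respect to the standard bases, the augmentation
`F₀ → I` is given by a row `aug` of polynomials, and the differential `F (i+1) → F i` by a matrix
`diff i`. -/
structure MinimalGradedFreeResolution {n : ℕ} {K : Type*} [Field K]
    (I : Ideal (MvPolynomial (Fin n) K)) where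
  /-- the rank of `F i` -/
  rank : ℕ → ℕ
  /-- the degrees of the standard basis vectors of `F i` -/
  shift : ∀ i, Fin (rank i) → ℕ
  /-- the images in `I` of the standard basis vectors of `F 0` -/
  aug : Fin (rank 0) → MvPolynomial (Fin n) K
  /-- the matrices of the differentials -/
  diff : ∀ i, Matrix (Fin (rank i)) (Fin (rank (i + 1))) (MvPolynomial (Fin n) K)
  /-- the augmentation is homogeneous of degree `0` -/
  aug_homogeneous : ∀ j, (aug j).IsHomogeneous (shift 0 j)
  /-- the differentials are homogeneous of degree `0`: the `(r, c)` entry of the matrix is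
  homogeneous of degree `shift (i + 1) c - shift i r` (hence zero if that number is negative) -/
  diff_homogeneous : ∀ i r c, diff i r c ≠ 0 →
    ∃ e : ℕ, shift (i + 1) c = shift i r + e ∧ (diff i r c).IsHomogeneous e
  /-- minimality: the image of each differential lies in `(x₁, …, xₙ) F i` -/
  minimal : ∀ i r c, constantCoeff (diff i r c) = 0
  /-- `F₀ → I` is surjective -/
  span_aug : Ideal.span (Set.range aug) = I
  /-- exactness at `F 0` -/
  exact_zero : Function.Exact (diff 0).mulVecLin (Fintype.linearCombination
    (MvPolynomial (Fin n) K) aug)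
  /-- exactness at `F (i + 1)` -/
  exact_succ : ∀ i, Function.Exact (diff (i + 1)).mulVecLin (diff i).mulVecLin

/-- `I` has a linear resolution: for some `d`, it has a minimal graded free resolution with
`F i = S(-d-i)^{b i}` for all `i ≥ 0`. -/
def HasLinearResolution {n : ℕ} {K : Type*} [Field K]
    (I : Ideal (MvPolynomial (Fin n) K)) : Prop :=
  ∃ (d : ℕ) (F : MinimalGradedFreeResolution I), ∀ i j, F.shift i j = d + i

/-- The complementary edge ideal of `G`: it is generated by the products of all the variables
outside `e`, for `e` an edge of `G`. -/
noncomputable def complementaryEdgeIdeal {n : ℕ} (K : Type*) [Field K]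
    (G : SimpleGraph (Fin n)) : Ideal (MvPolynomial (Fin n) K) :=
  Ideal.span ((fun e : Sym2 (Fin n) =>
    ∏ i ∈ Finset.univ.filter (fun i => i ∉ e), (X i : MvPolynomial (Fin n) K)) '' G.edgeSet)

/-- The number of connected components of `G` having more than one vertex. -/
noncomputable def numNontrivialComponents {n : ℕ} (G : SimpleGraph (Fin n)) : ℕ :=
  Set.ncard {C : G.ConnectedComponent | 1 < C.supp.ncard}

end MonomialIdeal

/-!
Write `x^c` for a monomial with exponent vector `c`. The generators of `I_c(G)ᵏ` are the monomials
`(x₁ ⋯ xₙ)ᵏ / x^δ`, where `δ` runs through the degree vectors of multisets of `k` edges of `G`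
(`IsEdgeSum`, `complementaryEdgeIdeal_pow_eq_span`). They all have the same degree, so they are the
minimal generators.

* *One nontrivial component implies linear quotients of all powers*
  (`hasLinearQuotients_complementaryEdgeIdeal_pow`). Choose a vertex `r` of the component and order
  the vertices by decreasing distance from `r`. Order the generators by comparing their `δ` at the
  first vertex `b` where they differ, the smaller value first. Linear quotients amount to an
  exchange property: if `δ` exceeds `δ'` at this `b`, then some `δ - b + q`, with `q` later than
  `b`, is again a degree vector. Follow an alternating trail from `b` through the two edge
  multisets (`IsEdgeSum.exchange`). It either ends at a suitable `q`, or it shows that `δ - b - w`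
  is a degree vector for some `w` not before `b`; in the second case `w` has a neighbour `q` later
  than `b`, so that `wq` can be added as an edge (`IsEdgeSum.exchange_of_ordering`).

* *Linear quotients in one degree imply a linear resolution*
  (`IsLinearQuotientSeq.hasLinearResolution`). The notion of linear quotients makes sense for
  sequences in a free module, and the syzygies of such a sequence are again generated by a sequence
  with linear quotients, consisting of vectors of linear forms
  (`IsLinearQuotientSeq.exists_syzygies`). Iterating gives the resolution.

* *A linear resolution implies one nontrivial component* (`reachable_of_hasLinearResolution`). An
  edge in one component and an edge in another are disjoint, so the least common multiple of their
  generators is `x₁ ⋯ xₙ`, of degree two more than the generators. Their syzygy is not a consequence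
  of linear ones (`not_hasLinearResolution_of_sup`).

The graph is determined by the ideal because its edges are the complements of the minimal
generators (`complementaryEdgeIdeal_injective`, `exists_eq_complementaryEdgeIdeal`).
-/

namespace MonomialIdeal

/-! ### Linear quotients and linear resolutions -/

theorem homogeneousComponent_mul_of_isHomogeneous {σ R : Type*} [CommSemiring R]
    {f : MvPolynomial σ R} {D : ℕ} (hf : f.IsHomogeneous D) (c : MvPolynomial σ R) (e : ℕ) :
    homogeneousComponent (e + D) (c * f) = homogeneousComponent e c * f := by
  have hc (i : ℕ) : homogeneousComponent (e + D) (homogeneousComponent i c * f) =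
      if e = i then homogeneousComponent i c * f else 0 := by
    rw [homogeneousComponent_of_mem ((homogeneousComponent_isHomogeneous i c).mul hf)]
    simp
  conv_lhs => rw [← sum_homogeneousComponent c, Finset.sum_mul, map_sum]
  simp only [hc, Finset.sum_ite_eq, Finset.mem_range]
  split_ifs with h
  · rfl
  · rw [homogeneousComponent_eq_zero _ _ (by omega), zero_mul]

section Syzygies

variable {n : ℕ} {K : Type*} [Field K]

local notation "S" => MvPolynomial (Fin n) K

/-- A sequence `f₁, …, fₘ` of vectors in the free module `Sʳ` has *linear quotients* if all
coordinates of the `fⱼ` are homogeneous of one degree `D` and each colon ideal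
`(f₁, …, f_{j-1}) : fⱼ`, the one with `j = 1` included, is generated by variables. -/
structure IsLinearQuotientSeq {r m : ℕ} (D : ℕ)
    (f : Fin m → Fin r → S) : Prop where
  homogeneous : ∀ j i, (f j i).IsHomogeneous D
  colon : ∀ j, ∃ V : Set (Fin n), ∀ s : S,
    s • f j ∈ Submodule.span S (f '' Set.Iio j) ↔
      s ∈ Ideal.span ((fun i => (X i : S)) '' V)

/-- If `x f` lies in the span of `f₁, …, f_{j-1}`, where `x` is a linear form, then it is a
combination of them with linear coefficients. -/
theorem exists_linear_syzygy {r m D : ℕ}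
    {f : Fin m → Fin r → S} (hf : ∀ j i, (f j i).IsHomogeneous D)
    {j : Fin m} {v : Fin n}
    (h : (X v : S) • f j ∈
      Submodule.span S (f '' Set.Iio j)) :
    ∃ g : Fin m → S, (∀ i, (g i).IsHomogeneous 1) ∧
      Fintype.linearCombination S f g = 0 ∧
      g j = X v ∧ ∀ i, j < i → g i = 0 := by
  rw [Finsupp.mem_span_image_iff_linearCombination] at h
  obtain ⟨c, hc, hcj⟩ := h
  have hc0 : ∀ i, j ≤ i → c i = 0 := fun i hi => by
    by_contra h0
    exact absurd (hc (Finsupp.mem_support_iff.2 h0)) (by simpa using hi)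
  refine ⟨fun i => (if i = j then X v else 0) - homogeneousComponent 1 (c i), fun i => ?_, ?_, ?_,
    fun i hi => ?_⟩
  · refine IsHomogeneous.sub ?_ (homogeneousComponent_isHomogeneous 1 _)
    split_ifs
    · exact isHomogeneous_X _ _
    · exact isHomogeneous_zero _ _ _
  · ext1 t
    have h1 : X v * f j t = ∑ i, c i * f i t := by
      have := congrFun hcj t
      rw [Finsupp.linearCombination_apply, Finsupp.sum_fintype _ _ (by simp)] at this
      simpa [Finset.sum_apply] using this.symm
    have h2 : X v * f j t = ∑ i, homogeneousComponent 1 (c i) * f i t := by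
      have := congrArg (homogeneousComponent (1 + D)) h1
      rw [map_sum, homogeneousComponent_eq_self ((isHomogeneous_X K v).mul (hf j t))] at this
      rw [this]
      exact Finset.sum_congr rfl fun i _ =>
        homogeneousComponent_mul_of_isHomogeneous (hf i t) (c i) 1
    simp [Fintype.linearCombination_apply, Finset.sum_apply, sub_mul, Finset.sum_sub_distrib, h2]
  · simp [hc0 j le_rfl]
  · simp [hc0 i hi.le, hi.ne']

/-- The syzygies of a sequence with linear quotients again form a module generated by a sequence
with linear quotients, whose entries are linear forms. If `(f₁, …, f_{j-1}) : fⱼ` is generated by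
the variables in `V j`, the generators are syzygies `g (j, v)`, for `v ∈ V j`, with leading
coordinate `X v` at `j`; they are ordered lexicographically. -/
theorem IsLinearQuotientSeq.exists_syzygies {r m D : ℕ}
    {f : Fin m → Fin r → S} (hf : IsLinearQuotientSeq D f) :
    ∃ (m' : ℕ) (g : Fin m' → Fin m → S), IsLinearQuotientSeq 1 g ∧
      Submodule.span S (Set.range g) =
        LinearMap.ker (Fintype.linearCombination S f) := by
  classical
  set φ := Fintype.linearCombination S f with hφ
  choose V hV using hf.colon
  have hsyz : ∀ p : Fin m ×ₗ Fin n, ∃ g : Fin m → S, (ofLex p).2 ∈ V (ofLex p).1 →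
      (∀ i, (g i).IsHomogeneous 1) ∧ φ g = 0 ∧ g (ofLex p).1 = X (ofLex p).2 ∧
        ∀ i, (ofLex p).1 < i → g i = 0 := fun p => by
    by_cases hp : (ofLex p).2 ∈ V (ofLex p).1
    · obtain ⟨g, hg⟩ := exists_linear_syzygy hf.homogeneous
        ((hV (ofLex p).1 (X (ofLex p).2)).2 (Ideal.subset_span ⟨_, hp, rfl⟩))
      exact ⟨g, fun _ => hg⟩
    · exact ⟨0, fun h => absurd h hp⟩
  choose G hG using hsyz
  -- The submodule spanned by the syzygies with leading coordinate before `j` consists of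
  -- all syzygies supported before `j`.
  have hker : ∀ (N : ℕ) (s : Fin m → S), φ s = 0 → (∀ i : Fin m, N ≤ i → s i = 0) →
      s ∈ Submodule.span S (G '' {p | (ofLex p).2 ∈ V (ofLex p).1 ∧ ((ofLex p).1 : ℕ) < N}) := by
    intro N
    induction N with
    | zero =>
      intro s _ hs
      rw [show s = 0 from funext fun i => hs i (Nat.zero_le _)]
      exact Submodule.zero_mem _
    | succ N ih =>
      intro s hs hsN
      have hmono : Submodule.span S
          (G '' {p | (ofLex p).2 ∈ V (ofLex p).1 ∧ ((ofLex p).1 : ℕ) < N}) ≤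
          Submodule.span S
          (G '' {p | (ofLex p).2 ∈ V (ofLex p).1 ∧ ((ofLex p).1 : ℕ) < N + 1}) :=
        Submodule.span_mono (Set.image_mono fun p hp => ⟨hp.1, hp.2.trans (Nat.lt_succ_self _)⟩)
      by_cases hNm : N < m
      swap
      · exact hmono (ih s hs fun i hi => absurd (i.2.trans_le (not_lt.1 hNm)) (not_lt.2 hi))
      set j : Fin m := ⟨N, hNm⟩ with hj
      have hsj : s j ∈ Ideal.span ((fun i => (X i : S)) '' V j) := by
        rw [← hV]
        have h0 : s j • f j = - ∑ i ∈ Finset.univ.erase j, s i • f i := by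
          rw [eq_neg_iff_add_eq_zero, Finset.add_sum_erase _ (fun i => s i • f i)
            (Finset.mem_univ j)]
          exact hs
        rw [h0]
        refine Submodule.neg_mem _ (Submodule.sum_mem _ fun i hi => ?_)
        by_cases hij : i < j
        · exact Submodule.smul_mem _ _ (Submodule.subset_span ⟨i, hij, rfl⟩)
        · have : s i = 0 := hsN i (by
            have h1 : i ≠ j := (Finset.mem_erase.1 hi).1
            have : j < i := lt_of_le_of_ne (not_lt.1 hij) h1.symm
            exact this)
          rw [this, zero_smul]
          exact Submodule.zero_mem _
      -- Subtracting a combination `t` of the `G (j, v)` with `t j = s j` shortens the support.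
      have hle : Ideal.span ((fun i => (X i : S)) '' V j) ≤
          Submodule.map (LinearMap.proj j : (Fin m → S) →ₗ[S] S)
            (Submodule.span S (G '' {p | (ofLex p).2 ∈ V (ofLex p).1 ∧ (ofLex p).1 = j})) := by
        refine Submodule.span_le.2 ?_
        rintro _ ⟨v, hv, rfl⟩
        exact ⟨G (toLex (j, v)), Submodule.subset_span ⟨toLex (j, v), ⟨hv, rfl⟩, rfl⟩,
          (hG (toLex (j, v)) hv).2.2.1⟩
      obtain ⟨t, ht, htj⟩ := hle hsj
      have ht0 : φ t = 0 ∧ ∀ i, j < i → t i = 0 := by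
        have : Submodule.span S (G '' {p | (ofLex p).2 ∈ V (ofLex p).1 ∧ (ofLex p).1 = j}) ≤
            LinearMap.ker φ ⊓ ⨅ i : Set.Ioi j, LinearMap.ker
              (LinearMap.proj (i : Fin m) : (Fin m → S) →ₗ[S] S) := by
          refine Submodule.span_le.2 ?_
          rintro _ ⟨p, ⟨hp, hpj⟩, rfl⟩
          refine ⟨(hG p hp).2.1, ?_⟩
          simp only [SetLike.mem_coe, Submodule.mem_iInf]
          exact fun i => (hG p hp).2.2.2 i (lt_of_eq_of_lt hpj i.2)
        have h := this ht
        refine ⟨h.1, fun i hi => ?_⟩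
        have h2 := h.2
        simp only [SetLike.mem_coe, Submodule.mem_iInf] at h2
        exact h2 ⟨i, hi⟩
      have hst : s - t ∈ Submodule.span S
          (G '' {p | (ofLex p).2 ∈ V (ofLex p).1 ∧ ((ofLex p).1 : ℕ) < N}) := by
        refine ih _ (by rw [map_sub, hs, ht0.1, sub_zero]) fun i hi => ?_
        rcases hi.eq_or_lt with h | h
        · rw [show i = j from Fin.ext h.symm]
          exact sub_eq_zero.2 htj.symm
        · simp [hsN i h, ht0.2 i h]
      rw [← sub_add_cancel s t]
      refine Submodule.add_mem _ (hmono hst) (Submodule.span_mono (Set.image_mono ?_) ht)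
      rintro p ⟨hp, hpj⟩
      exact ⟨hp, by simp [hpj, hj]⟩
  set T : Finset (Fin m ×ₗ Fin n) := Finset.univ.filter fun p => (ofLex p).2 ∈ V (ofLex p).1
    with hT
  have hTm : ∀ p, p ∈ T ↔ (ofLex p).2 ∈ V (ofLex p).1 := fun p => by simp [hT]
  set o := T.orderIsoOfFin rfl with ho
  have him : ∀ a, (fun a => G (o a)) '' Set.Iio a = G '' {p | p ∈ T ∧ p < o a} := by
    intro a
    ext x
    constructor
    · rintro ⟨b, hb, rfl⟩
      exact ⟨o b, ⟨(o b).2, o.lt_iff_lt.2 hb⟩, rfl⟩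
    · rintro ⟨p, ⟨hp, hlt⟩, rfl⟩
      refine ⟨o.symm ⟨p, hp⟩, ?_, by simp⟩
      rw [Set.mem_Iio, ← o.lt_iff_lt, o.apply_symm_apply]
      exact hlt
  refine ⟨T.card, fun a => G (o a), ⟨fun a i => (hG _ ((hTm _).1 (o a).2)).1 i, fun a => ?_⟩, ?_⟩
  · rw [him]
    have hpV := (hTm _).1 (o a).2
    generalize ((o a : T) : Fin m ×ₗ Fin n) = p at hpV ⊢
    obtain ⟨-, hp1, hp2, hp3⟩ := hG p hpV
    refine ⟨{v | v ∈ V (ofLex p).1 ∧ v < (ofLex p).2}, fun s => ?_⟩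
    constructor
    · intro hs
      -- The leading coordinate of `G p` is a variable, and at that coordinate the earlier generators
      -- are `0` or earlier variables; as the former is no zero divisor modulo these, it cancels.
      have hle : Submodule.span S (G '' {q | q ∈ T ∧ q < p}) ≤
          Submodule.comap (LinearMap.proj (ofLex p).1 : (Fin m → S) →ₗ[S] S)
            (Ideal.span ((fun i => (X i : S)) ''
              {v | v ∈ V (ofLex p).1 ∧ v < (ofLex p).2})) := by
        refine Submodule.span_le.2 ?_
        rintro _ ⟨q, ⟨hq, hqp⟩, rfl⟩
        obtain ⟨-, -, hq2, hq3⟩ := hG q ((hTm q).1 hq)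
        change G q (ofLex p).1 ∈ Ideal.span _
        rcases Prod.Lex.lt_iff.1 hqp with h | ⟨h, h'⟩
        · rw [hq3 _ h]
          exact Ideal.zero_mem _
        · rw [← h, hq2]
          exact Ideal.subset_span ⟨_, ⟨(hTm q).1 hq, h'⟩, rfl⟩
      have h := hle hs
      change s * G p (ofLex p).1 ∈ Ideal.span _ at h
      rw [hp2, mem_ideal_span_X_image] at h
      rw [mem_ideal_span_X_image]
      intro e he
      obtain ⟨v, hv, hve⟩ := h (e + Finsupp.single (ofLex p).2 1) (by
        rw [mem_support_iff, coeff_mul_X]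
        exact mem_support_iff.1 he)
      exact ⟨v, hv, by simpa [Finsupp.single_apply, hv.2.ne'] using hve⟩
    · intro hs
      have hle : Ideal.span ((fun i => (X i : S)) '' {v | v ∈ V (ofLex p).1 ∧ v < (ofLex p).2}) ≤
          Submodule.comap (LinearMap.toSpanSingleton S (Fin m → S) (G p))
            (Submodule.span S (G '' {q | q ∈ T ∧ q < p})) := by
        refine Submodule.span_le.2 ?_
        rintro _ ⟨v, ⟨hv, hvp⟩, rfl⟩
        set q : Fin m ×ₗ Fin n := toLex ((ofLex p).1, v) with hq
        have hqV : (ofLex q).2 ∈ V (ofLex q).1 := hv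
        have hqp : q < p := Prod.Lex.lt_iff.2 (Or.inr ⟨rfl, hvp⟩)
        obtain ⟨-, hq1, hq2, hq3⟩ := hG q hqV
        change (X v : S) • G p ∈ Submodule.span S _
        -- The Koszul-type relation: the leading coordinates cancel.
        rw [← sub_add_cancel ((X v : S) • G p) ((X (ofLex p).2 : S) • G q)]
        refine Submodule.add_mem _ ?_
          (Submodule.smul_mem _ _ (Submodule.subset_span ⟨q, ⟨(hTm q).2 hqV, hqp⟩, rfl⟩))
        refine Submodule.span_mono (Set.image_mono ?_)
          (hker (ofLex p).1 _ (by simp [hp1, hq1]) fun i hi => ?_)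
        · rintro q' ⟨h1, h2⟩
          exact ⟨(hTm _).2 h1, Prod.Lex.lt_iff.2 (Or.inl h2)⟩
        · rcases hi.eq_or_lt with h | h
          · have hq2' : G q (ofLex p).1 = X v := hq2
            rw [show i = (ofLex p).1 from Fin.ext h.symm]
            simp [hp2, hq2', mul_comm]
          · simp [hp3 i h, hq3 i h]
      exact hle hs
  · apply le_antisymm
    · refine Submodule.span_le.2 ?_
      rintro _ ⟨a, rfl⟩
      exact (hG _ ((hTm _).1 (o a).2)).2.1
    · intro s hs
      refine Submodule.span_mono ?_ (hker m s hs fun i hi => absurd i.2 (not_lt.2 hi))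
      rintro _ ⟨p, ⟨hp, -⟩, rfl⟩
      exact ⟨o.symm ⟨p, (hTm p).2 hp⟩, by simp⟩

end Syzygies

section Resolution

variable {n : ℕ} {K : Type*} [Field K]

local notation "S" => MvPolynomial (Fin n) K

/-- A step of the resolution built by iterating `IsLinearQuotientSeq.exists_syzygies`: a sequence
with linear quotients in some free module `Sʳ`. -/
structure LinearQuotientStep (n : ℕ) (K : Type*) [Field K] where
  /-- the rank of the ambient free module -/
  r : ℕ
  /-- the length of the sequence -/
  m : ℕ
  /-- the degree of the entries -/
  D : ℕ
  /-- the sequence -/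
  f : Fin m → Fin r → MvPolynomial (Fin n) K
  isLinearQuotientSeq : IsLinearQuotientSeq D f

/-- Pass from a sequence with linear quotients to such a sequence generating its syzygies. -/
noncomputable def LinearQuotientStep.next (s : LinearQuotientStep n K) :
    LinearQuotientStep n K where
  r := s.m
  m := s.isLinearQuotientSeq.exists_syzygies.choose
  D := 1
  f := s.isLinearQuotientSeq.exists_syzygies.choose_spec.choose
  isLinearQuotientSeq := s.isLinearQuotientSeq.exists_syzygies.choose_spec.choose_spec.1

theorem LinearQuotientStep.span_next (s : LinearQuotientStep n K) :
    Submodule.span S (Set.range s.next.f) = LinearMap.ker (Fintype.linearCombination S s.f) :=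
  s.isLinearQuotientSeq.exists_syzygies.choose_spec.choose_spec.2

/-- The iterated syzygies of a sequence with linear quotients. -/
noncomputable def LinearQuotientStep.iter (s : LinearQuotientStep n K) :
    ℕ → LinearQuotientStep n K
  | 0 => s
  | i + 1 => (s.iter i).next

theorem mulVecLin_transpose_eq_linearCombination {r m : ℕ} (f : Fin m → Fin r → S) :
    (Matrix.of fun i j => f j i : Matrix (Fin r) (Fin m) S).mulVecLin =
      Fintype.linearCombination S f := by
  refine LinearMap.ext fun v => funext fun i => ?_
  simp [Matrix.mulVec, dotProduct, Fintype.linearCombination_apply, Finset.sum_apply, mul_comm]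

theorem ker_linearCombination_fin_one {m : ℕ} (u : Fin m → S) :
    LinearMap.ker (Fintype.linearCombination S u) =
      LinearMap.ker (Fintype.linearCombination S fun j (_ : Fin 1) => u j) := by
  ext v
  simp only [LinearMap.mem_ker, Fintype.linearCombination_apply]
  constructor
  · intro h
    ext1 t
    simpa [Finset.sum_apply] using h
  · intro h
    simpa [Finset.sum_apply] using congrFun h (0 : Fin 1)

/-- An ideal generated by a sequence of forms of one degree with linear quotients has a linear
resolution: iterate `IsLinearQuotientSeq.exists_syzygies`. The resolution is minimal because the
entries of its matrices are linear forms. -/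
theorem IsLinearQuotientSeq.hasLinearResolution {m D : ℕ} {u : Fin m → S}
    (hu : IsLinearQuotientSeq D (fun j (_ : Fin 1) => u j)) :
    HasLinearResolution (Ideal.span (Set.range u)) := by
  let s : LinearQuotientStep n K := ⟨1, m, D, _, hu⟩
  have hhom : ∀ i (r : Fin (s.iter i).m) c, ((s.iter (i + 1)).f c r).IsHomogeneous 1 :=
    fun i r c => (s.iter i).next.isLinearQuotientSeq.homogeneous c r
  have hexact : ∀ i, LinearMap.range (Fintype.linearCombination S (s.iter (i + 1)).f) =
      LinearMap.ker (Fintype.linearCombination S (s.iter i).f) := fun i => by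
    rw [Fintype.range_linearCombination]
    exact (s.iter i).span_next
  refine ⟨D, {
    rank := fun i => (s.iter i).m
    shift := fun i _ => D + i
    aug := u
    diff := fun i => Matrix.of fun r c => (s.iter (i + 1)).f c r
    aug_homogeneous := fun j => hu.homogeneous j 0
    diff_homogeneous := fun i r c _ => ⟨1, rfl, hhom i r c⟩
    minimal := fun i r c => (hhom i r c).coeff_eq_zero (by simp)
    span_aug := rfl
    exact_zero := ?_
    exact_succ := fun i => ?_ }, fun _ _ => rfl⟩
  · rw [LinearMap.exact_iff]
    refine (ker_linearCombination_fin_one u).trans (Eq.trans (hexact 0).symm ?_)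
    exact congrArg LinearMap.range (mulVecLin_transpose_eq_linearCombination _).symm
  · rw [LinearMap.exact_iff]
    refine Eq.trans ?_ (Eq.trans (hexact (i + 1)).symm ?_)
    · exact congrArg LinearMap.ker (mulVecLin_transpose_eq_linearCombination _)
    · exact congrArg LinearMap.range (mulVecLin_transpose_eq_linearCombination _).symm

/-- The minimal generators of an ideal spanned by monomials of one degree. -/
theorem minGens_span_of_degree_eq {A : Set (Fin n →₀ ℕ)} {d : ℕ} (hA : ∀ a ∈ A, a.degree = d) :
    minGens (Ideal.span ((fun a => monomial a (1 : K)) '' A)) = A := by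
  have hmem : ∀ b : Fin n →₀ ℕ, monomial b (1 : K) ∈
      Ideal.span ((fun a => monomial a (1 : K)) '' A) ↔ ∃ a ∈ A, a ≤ b := fun b => by
    classical
    rw [mem_ideal_span_monomial_image, support_monomial, if_neg one_ne_zero]
    simp
  ext a
  simp only [minGens, Set.mem_ofPred_eq, hmem]
  constructor
  · rintro ⟨⟨b, hb, hba⟩, hmin⟩
    rwa [← le_antisymm hba (hmin ⟨b, hb, le_rfl⟩ hba)]
  · intro ha
    refine ⟨⟨a, ha, le_rfl⟩, ?_⟩
    rintro b ⟨c, hc, hcb⟩ hba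
    have hcd : c + (a - c) = a := add_tsub_cancel_of_le (hcb.trans hba)
    have h0 : (a - c).degree = 0 := by
      have := congrArg Finsupp.degree hcd
      rw [map_add, hA c hc, hA a ha] at this
      omega
    rw [Finsupp.degree_eq_zero_iff] at h0
    rw [h0, add_zero] at hcd
    exact hcd ▸ hcb

theorem HasLinearQuotients.hasLinearResolution {A : Set (Fin n →₀ ℕ)} {d : ℕ}
    (hA : ∀ a ∈ A, a.degree = d)
    (h : HasLinearQuotients (Ideal.span ((fun a => monomial a (1 : K)) '' A))) :
    HasLinearResolution (Ideal.span ((fun a => monomial a (1 : K)) '' A)) := by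
  obtain ⟨m, u, -, hrange, hcolon⟩ := h
  rw [minGens_span_of_degree_eq hA] at hrange
  have hspan : Ideal.span ((fun a => monomial a (1 : K)) '' A) =
      Ideal.span (Set.range fun j => (monomial (u j) (1 : K) : S)) := by
    rw [← hrange, ← Set.range_comp]
    rfl
  rw [hspan]
  refine IsLinearQuotientSeq.hasLinearResolution (D := d) ⟨fun j _ => ?_, fun j => ?_⟩
  · exact isHomogeneous_monomial _ (hA _ (hrange ▸ Set.mem_range_self j))
  · -- Membership in the span is the same in `S¹` as in `S`.
    have hmem : ∀ s : S, s • (fun _ : Fin 1 => (monomial (u j) (1 : K) : S)) ∈ Submodule.span S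
        ((fun i (_ : Fin 1) => (monomial (u i) (1 : K) : S)) '' Set.Iio j) ↔
        s * monomial (u j) 1 ∈
          Ideal.span ((fun i => (monomial (u i) (1 : K) : S)) '' Set.Iio j) := by
      intro s
      have hmap : Submodule.span S
          ((fun i (_ : Fin 1) => (monomial (u i) (1 : K) : S)) '' Set.Iio j) =
          Submodule.map (LinearMap.pi fun _ : Fin 1 => (LinearMap.id : S →ₗ[S] S))
            (Submodule.span S ((fun i => (monomial (u i) (1 : K) : S)) '' Set.Iio j)) := by
        rw [Submodule.map_span, Set.image_image]
        rfl
      rw [hmap, Submodule.mem_map]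
      constructor
      · rintro ⟨y, hy, hys⟩
        have : y = s * monomial (u j) 1 := congrFun hys (0 : Fin 1)
        exact this ▸ hy
      · exact fun h => ⟨_, h, rfl⟩
    rcases Nat.eq_zero_or_pos j with h0 | h0
    · refine ⟨∅, fun s => ?_⟩
      have : Set.Iio j = ∅ := Set.eq_empty_of_forall_notMem fun i hi => by
        have : (i : ℕ) < j := hi
        omega
      rw [hmem, this]
      simp
    · obtain ⟨V, hV⟩ := hcolon j h0
      refine ⟨V, fun s => ?_⟩
      rw [hmem, ← hV, Ideal.mem_colon_span_singleton]
      rfl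

end Resolution

/-! ### Degree vectors of edge multisets -/

section EdgeSum

/-- `IsEdgeSum G k δ` says that `δ` is the degree vector of a multiset of `k` edges of `G`. -/
inductive IsEdgeSum {V : Type*} (G : SimpleGraph V) : ℕ → (V →₀ ℕ) → Prop
  | zero : IsEdgeSum G 0 0
  | add_edge {k : ℕ} {δ : V →₀ ℕ} {u v : V} (h : IsEdgeSum G k δ) (huv : G.Adj u v) :
      IsEdgeSum G (k + 1) (δ + Finsupp.single u 1 + Finsupp.single v 1)

variable {V : Type*} {G : SimpleGraph V} {k l : ℕ} {δ δ' : V →₀ ℕ}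

theorem IsEdgeSum.degree (h : IsEdgeSum G k δ) : δ.degree = 2 * k := by
  induction h with
  | zero => simp
  | add_edge h huv ih =>
    simp only [map_add, Finsupp.degree_single, ih]
    ring

theorem IsEdgeSum.apply_le (h : IsEdgeSum G k δ) (x : V) : δ x ≤ k := by
  classical
  induction h with
  | zero => simp
  | @add_edge k δ u v h huv ih =>
    have := huv.ne
    simp only [Finsupp.add_apply, Finsupp.single_apply]
    split_ifs with h1 h2
    · exact absurd (h1.trans h2.symm) this
    all_goals omega

theorem IsEdgeSum.exists_edge (h : IsEdgeSum G k δ) {b : V} (hb : 0 < δ b) :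
    ∃ l v δ', k = l + 1 ∧ G.Adj b v ∧ IsEdgeSum G l δ' ∧
      δ = δ' + Finsupp.single b 1 + Finsupp.single v 1 := by
  classical
  induction h with
  | zero => simp at hb
  | @add_edge k δ u v h huv ih =>
    by_cases hu : u = b
    · exact ⟨k, v, δ, rfl, hu ▸ huv, h, by rw [hu]⟩
    by_cases hv : v = b
    · exact ⟨k, u, δ, rfl, hv ▸ huv.symm, h, by rw [hv, add_right_comm]⟩
    obtain ⟨l, w, δ', rfl, hw, h', rfl⟩ := ih (by simpa [Finsupp.single_apply, hu, hv] using hb)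
    exact ⟨l + 1, w, _, rfl, hw, h'.add_edge huv, by abel⟩

/-- Exchange property of the degree vectors of edge multisets. Suppose that `δ` exceeds `δ'` at `b`.
Follow an alternating trail from `b`, taking in turn an edge of a multiset for `δ` and an edge of
one for `δ'`. If it gets stuck at a vertex `q` where `δ'` exceeds `δ`, swapping the edges on the
trail replaces one `b` by `q` in `δ`. If it gets stuck at a vertex `w` where `δ` exceeds `δ'`, the
same swap shows that `δ - b - w` is again a degree vector. -/
theorem IsEdgeSum.exchange (h : IsEdgeSum G k δ) (h' : IsEdgeSum G l δ') {b : V}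
    (hb : δ' b < δ b) :
    (∃ q α, δ q < δ' q ∧ δ = α + Finsupp.single b 1 ∧ IsEdgeSum G k (α + Finsupp.single q 1)) ∨
    ∃ w α j, k = j + 1 ∧ δ' w + Finsupp.single b 1 w < δ w ∧ IsEdgeSum G j α ∧
      δ = α + Finsupp.single b 1 + Finsupp.single w 1 := by
  classical
  induction k generalizing l δ δ' b with
  | zero =>
    cases h
    simp at hb
  | succ k ih =>
    obtain ⟨k', v, δ₁, hk, hbv, h₁, rfl⟩ := h.exists_edge (Nat.zero_lt_of_lt hb)
    obtain rfl : k = k' := by omega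
    have hne := hbv.ne
    by_cases hv : δ' v < (δ₁ + Finsupp.single b 1 + Finsupp.single v 1 : V →₀ ℕ) v
    · exact Or.inr ⟨v, δ₁, k, rfl, by simpa [Finsupp.single_apply, hne] using hv, h₁, rfl⟩
    obtain ⟨l', u, δ₁', rfl, hvu, h₁', rfl⟩ := h'.exists_edge (b := v) (by
      simp at hv
      omega)
    by_cases hu : (δ₁ + Finsupp.single b 1 + Finsupp.single v 1 : V →₀ ℕ) u <
        (δ₁' + Finsupp.single v 1 + Finsupp.single u 1 : V →₀ ℕ) u
    · exact Or.inl ⟨u, δ₁ + Finsupp.single v 1, hu, by abel, h₁.add_edge hvu⟩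
    have hlt : δ₁' u < δ₁ u := by
      simp only [Finsupp.add_apply, Finsupp.single_apply] at hb hu
      by_cases hbu : b = u
      · subst hbu
        simp at hb
        omega
      · simp [hbu] at hu
        omega
    rcases ih h₁ h₁' hlt with ⟨q, α, hq, rfl, hα⟩ | ⟨w, α, j, rfl, hw, hα, rfl⟩
    · refine Or.inl ⟨q, α + Finsupp.single v 1 + Finsupp.single u 1, ?_, by abel, ?_⟩
      · simp only [Finsupp.add_apply, Finsupp.single_apply] at hb hq ⊢
        by_cases hbq : b = q
        · subst hbq
          simp at hb
          omega
        · simp only [hbq, if_false]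
          omega
      · have := hα.add_edge hvu
        convert this using 1
        abel
    · refine Or.inr ⟨w, α + Finsupp.single v 1 + Finsupp.single u 1, j + 1, rfl, ?_,
        hα.add_edge hvu, by abel⟩
      simp only [Finsupp.add_apply, Finsupp.single_apply] at hw ⊢
      omega

/-- Exchange along an ordering `pos` of the vertices in which every non-isolated vertex other than
`r` has a neighbour of larger position. If `b` is the first vertex at which `δ` and `δ'` differ and
`δ` is larger there, then one `b` in `δ` can be replaced by a vertex `q` of larger position. -/
theorem IsEdgeSum.exchange_of_ordering {P : Type*} [LinearOrder P] [WellFoundedGT P] {pos : V → P}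
    (hinj : Function.Injective pos) {r : V}
    (hpos : ∀ v ≠ r, (∃ u, G.Adj v u) → ∃ u, G.Adj v u ∧ pos v < pos u)
    (h : IsEdgeSum G k δ) (h' : IsEdgeSum G k δ') {b : V} (hb : δ' b < δ b)
    (hlt : ∀ x, pos x < pos b → δ' x = δ x) :
    ∃ q α, pos b < pos q ∧ δ = α + Finsupp.single b 1 ∧
      IsEdgeSum G k (α + Finsupp.single q 1) := by
  classical
  have hle : ∀ x, δ' x ≠ δ x → pos b ≤ pos x := fun x hx => not_lt.1 fun hxb => hx (hlt x hxb)
  have hltq : ∀ x, δ x < δ' x → pos b < pos x := fun x hx =>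
    (hle x hx.ne').lt_of_ne fun he => by
      rw [← hinj he] at hx
      omega
  have hadj : ∀ {δ : V →₀ ℕ}, IsEdgeSum G k δ → ∀ x, 0 < δ x → ∃ u, G.Adj x u := fun h x hx => by
    obtain ⟨-, u, -, -, hu, -⟩ := h.exists_edge hx
    exact ⟨u, hu⟩
  rcases h.exchange h' hb with ⟨q, α, hq, hα, hqα⟩ | ⟨w, α, j, rfl, hw, hα, rfl⟩
  · exact ⟨q, α, hltq q hq, hα, hqα⟩
  -- It remains to find a neighbour of `w` of larger position than `b`.
  suffices hc : ∃ c, G.Adj w c ∧ pos b < pos c by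
    obtain ⟨c, hwc, hbc⟩ := hc
    exact ⟨c, α + Finsupp.single w 1, hbc, by abel, hα.add_edge hwc⟩
  set δ := α + Finsupp.single b 1 + Finsupp.single w 1 with hδ
  have hw' : δ' w < δ w := by omega
  by_cases hwr : w = r
  · -- As `δ` and `δ'` have the same total, `δ'` exceeds `δ` somewhere, away from `r`.
    obtain ⟨c, hc⟩ : ∃ c, δ c < δ' c := by
      by_contra! hcon
      have hsub : δ' + (δ - δ') = δ := add_tsub_cancel_of_le (Finsupp.le_def.2 hcon)
      have hdeg := congrArg Finsupp.degree hsub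
      rw [map_add, h.degree, h'.degree] at hdeg
      have h0 : δ - δ' = 0 := (Finsupp.degree_eq_zero_iff _).1 (by omega)
      rw [h0, add_zero] at hsub
      rw [hsub] at hb
      exact lt_irrefl _ hb
    have hroot : ∀ c ≠ r, (∃ u, G.Adj c u) → ∃ d, G.Adj r d ∧ pos c ≤ pos d := by
      intro c
      induction hp : pos c using WellFoundedGT.induction generalizing c with
      | ind p ih =>
        subst hp
        intro hcr hcu
        obtain ⟨d, hcd, hlt⟩ := hpos c hcr hcu
        by_cases hdr : d = r
        · exact ⟨c, hdr ▸ hcd.symm, le_rfl⟩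
        · obtain ⟨e, he, hde⟩ := ih _ hlt d rfl hdr ⟨c, hcd.symm⟩
          exact ⟨e, he, hlt.le.trans hde⟩
    obtain ⟨d, hd, hcd⟩ := hroot c (by
      rintro rfl
      rw [hwr] at hw'
      omega) (hadj h' c (by omega))
    exact ⟨d, hwr ▸ hd, (hltq c hc).trans_le hcd⟩
  · obtain ⟨c, hc, hlt⟩ := hpos w hwr (hadj h w (by omega))
    exact ⟨c, hc, (hle w hw'.ne).trans_lt hlt⟩

/-- If all non-isolated vertices of `G` are reachable from `r`, the vertices can be ordered by
decreasing distance from `r`; then every non-isolated vertex other than `r` has a neighbour of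
larger position. -/
theorem exists_ordering {n : ℕ} {G : SimpleGraph (Fin n)} {r : Fin n}
    (hr : ∀ v, (∃ u, G.Adj v u) → G.Reachable v r) :
    ∃ pos : Equiv.Perm (Fin n),
      ∀ v ≠ r, (∃ u, G.Adj v u) → ∃ u, G.Adj v u ∧ pos v < pos u := by
  set f : Fin n → ℕᵒᵈ := fun v => OrderDual.toDual (G.dist v r) with hf
  refine ⟨(Tuple.sort f).symm, fun v hv hu => ?_⟩
  obtain ⟨p, hp⟩ := (hr v hu).exists_walk_length_eq_dist
  cases p with
  | nil => exact absurd rfl hv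
  | @cons _ u _ hvu p =>
    refine ⟨u, hvu, not_le.1 fun hle => ?_⟩
    have h1 := Tuple.monotone_sort f hle
    simp only [Function.comp_apply, Equiv.apply_symm_apply, hf, OrderDual.toDual_le_toDual] at h1
    have h2 := G.dist_le p
    rw [SimpleGraph.Walk.length_cons] at hp
    omega

end EdgeSum

/-! ### Powers of complementary edge ideals -/

section Powers

variable {n : ℕ} {K : Type*} [Field K]

/-- The exponent vector of `(x₁ ⋯ xₙ)ᵏ`. -/
noncomputable def constExp (n k : ℕ) : Fin n →₀ ℕ :=
  Finsupp.equivFunOnFinite.symm fun _ => k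

@[simp]
theorem constExp_apply (k : ℕ) (i : Fin n) : constExp n k i = k := rfl

theorem degree_constExp (n k : ℕ) : (constExp n k).degree = n * k := by
  simp [Finsupp.degree_eq_sum]

theorem constExp_add (n k l : ℕ) : constExp n (k + l) = constExp n k + constExp n l := by
  ext i
  simp

/-- The exponent vectors of the generators of `I_c(G)ᵏ`: the complements of the degree vectors of
`k` edges of `G` in the exponent vector of `(x₁ ⋯ xₙ)ᵏ`. -/
def powExponents (G : SimpleGraph (Fin n)) (k : ℕ) : Set (Fin n →₀ ℕ) :=
  {a | ∃ δ, IsEdgeSum G k δ ∧ a + δ = constExp n k}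

variable {G : SimpleGraph (Fin n)} {k : ℕ}

theorem degree_of_mem_powExponents {a : Fin n →₀ ℕ} (ha : a ∈ powExponents G k) :
    a.degree = n * k - 2 * k := by
  obtain ⟨δ, hδ, h⟩ := ha
  have := congrArg Finsupp.degree h
  rw [map_add, hδ.degree, degree_constExp] at this
  omega

theorem IsEdgeSum.exists_compl {δ : Fin n →₀ ℕ} (h : IsEdgeSum G k δ) :
    ∃ a, a + δ = constExp n k :=
  ⟨constExp n k - δ, tsub_add_cancel_of_le (Finsupp.le_def.2 h.apply_le)⟩

theorem mem_powExponents_one {a : Fin n →₀ ℕ} : a ∈ powExponents G 1 ↔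
    ∃ u v, G.Adj u v ∧ a + Finsupp.single u 1 + Finsupp.single v 1 = constExp n 1 := by
  constructor
  · rintro ⟨δ, hδ, h⟩
    obtain _ | ⟨_, huv⟩ := hδ
    rename_i u v h0
    cases h0
    exact ⟨u, v, huv, by rwa [zero_add, ← add_assoc] at h⟩
  · rintro ⟨u, v, huv, h⟩
    exact ⟨0 + Finsupp.single u 1 + Finsupp.single v 1, IsEdgeSum.zero.add_edge huv, by
      rwa [zero_add, ← add_assoc]⟩

theorem complementaryEdgeIdeal_eq_span (G : SimpleGraph (Fin n)) :
    complementaryEdgeIdeal K G =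
      Ideal.span ((fun a => monomial a (1 : K)) '' powExponents G 1) := by
  classical
  have hprod : ∀ {a : Fin n →₀ ℕ} {u v : Fin n}, u ≠ v →
      a + Finsupp.single u 1 + Finsupp.single v 1 = constExp n 1 →
      ∏ i ∈ Finset.univ.filter (fun i => i ∉ s(u, v)), (X i : MvPolynomial (Fin n) K) =
        monomial a 1 := by
    intro a u v huv h
    have ha : ∀ i, a i = if i ∉ s(u, v) then 1 else 0 := fun i => by
      have hi := DFunLike.congr_fun h i
      simp only [Finsupp.add_apply, Finsupp.single_apply, constExp_apply] at hi
      by_cases h1 : u = i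
      · subst h1
        simp [huv.symm] at hi
        simp [hi]
      · by_cases h2 : v = i
        · subst h2
          simp [huv] at hi
          simp [hi]
        · simpa [h1, h2, Ne.symm h1, Ne.symm h2, eq_comm (a := i)] using hi
    rw [monomial_eq, C_1, one_mul, Finsupp.prod_fintype _ _ (by simp), Finset.prod_filter]
    refine Finset.prod_congr rfl fun i _ => ?_
    rw [ha]
    split_ifs <;> simp
  unfold complementaryEdgeIdeal
  congr 1
  ext x
  constructor
  · rintro ⟨e, he, rfl⟩
    induction e with
    | h u v =>
      have huv : G.Adj u v := he
      obtain ⟨a, ha⟩ := (IsEdgeSum.zero.add_edge huv).exists_compl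
      rw [zero_add, ← add_assoc] at ha
      exact ⟨a, mem_powExponents_one.2 ⟨u, v, huv, ha⟩, (hprod huv.ne ha).symm⟩
  · rintro ⟨a, ha, rfl⟩
    obtain ⟨u, v, huv, h⟩ := mem_powExponents_one.1 ha
    exact ⟨s(u, v), huv, hprod huv.ne h⟩

theorem powExponents_zero : powExponents G 0 = {0} := by
  ext a
  constructor
  · rintro ⟨δ, hδ, h⟩
    cases hδ
    rw [add_zero] at h
    rw [h]
    ext i
    simp
  · rintro rfl
    refine ⟨0, IsEdgeSum.zero, ?_⟩
    ext i
    simp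

theorem mem_powExponents_succ {a : Fin n →₀ ℕ} : a ∈ powExponents G (k + 1) ↔
    ∃ b ∈ powExponents G k, ∃ c ∈ powExponents G 1, b + c = a := by
  constructor
  · rintro ⟨δ, hδ, h⟩
    obtain _ | ⟨hδ', huv⟩ := hδ
    rename_i δ u v
    obtain ⟨b, hb⟩ := hδ'.exists_compl
    obtain ⟨c, hc⟩ := (IsEdgeSum.zero.add_edge huv).exists_compl
    refine ⟨b, ⟨δ, hδ', hb⟩, c, ⟨_, IsEdgeSum.zero.add_edge huv, hc⟩, ?_⟩
    rw [constExp_add, ← hb, ← hc] at h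
    refine add_right_cancel (b := δ + Finsupp.single u 1 + Finsupp.single v 1) (h.trans ?_).symm
    abel
  · rintro ⟨b, ⟨δ, hδ, hb⟩, c, hc, rfl⟩
    obtain ⟨u, v, huv, h⟩ := mem_powExponents_one.1 hc
    refine ⟨_, hδ.add_edge huv, ?_⟩
    rw [constExp_add, ← hb, ← h]
    abel

theorem complementaryEdgeIdeal_pow_eq_span (G : SimpleGraph (Fin n)) (k : ℕ) :
    complementaryEdgeIdeal K G ^ k =
      Ideal.span ((fun a => monomial a (1 : K)) '' powExponents G k) := by
  induction k with
  | zero => simp [powExponents_zero]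
  | succ k ih =>
    rw [pow_succ, ih, complementaryEdgeIdeal_eq_span, Ideal.span_mul_span]
    congr 1
    ext x
    constructor
    · rintro ⟨_, ⟨b, hb, rfl⟩, _, ⟨c, hc, rfl⟩, rfl⟩
      exact ⟨b + c, mem_powExponents_succ.2 ⟨b, hb, c, hc, rfl⟩, by simp [monomial_mul]⟩
    · rintro ⟨_, ha, rfl⟩
      obtain ⟨b, hb, c, hc, rfl⟩ := mem_powExponents_succ.1 ha
      exact ⟨_, ⟨b, hb, rfl⟩, _, ⟨c, hc, rfl⟩, by simp [monomial_mul]⟩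

theorem hasLinearResolution_complementaryEdgeIdeal_pow
    (h : HasLinearQuotients (complementaryEdgeIdeal K G ^ k)) :
    HasLinearResolution (complementaryEdgeIdeal K G ^ k) := by
  rw [complementaryEdgeIdeal_pow_eq_span] at h ⊢
  exact h.hasLinearResolution fun a => degree_of_mem_powExponents

/-- Criterion for linear quotients of an ideal generated by monomials of one degree: they are
ordered by `key`, and for `a` before `b` some `c` before `b` satisfies `x^c ∣ x_p x^b`, where `x_p`
divides `x^a / gcd(x^a, x^b)`. -/
theorem hasLinearQuotients_of_order {A : Set (Fin n →₀ ℕ)} {d : ℕ} (hA : ∀ a ∈ A, a.degree = d)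
    (hfin : A.Finite) {P : Type*} [LinearOrder P] {key : (Fin n →₀ ℕ) → P}
    (hinj : Function.Injective key)
    (h : ∀ a ∈ A, ∀ b ∈ A, key a < key b → ∃ c ∈ A, key c < key b ∧
      ∃ p, b p < a p ∧ c ≤ b + Finsupp.single p 1) :
    HasLinearQuotients (Ideal.span ((fun a => monomial a (1 : K)) '' A)) := by
  classical
  set T : Finset P := hfin.toFinset.image key with hT
  set o := T.orderIsoOfFin rfl with ho
  have hex : ∀ j, ∃ a ∈ A, key a = o j := fun j => by
    obtain ⟨a, ha, hao⟩ := Finset.mem_image.1 (o j).2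
    exact ⟨a, hfin.mem_toFinset.1 ha, hao⟩
  choose u huA hu using hex
  have hrange : ∀ a ∈ A, ∃ j, u j = a := fun a ha => by
    have hT' : key a ∈ T := Finset.mem_image_of_mem _ (hfin.mem_toFinset.2 ha)
    refine ⟨o.symm ⟨_, hT'⟩, hinj ?_⟩
    rw [hu, o.apply_symm_apply]
  have hlt : ∀ i j, key (u i) < key (u j) ↔ i < j := fun i j => by
    rw [hu, hu, Subtype.coe_lt_coe, o.lt_iff_lt]
  refine ⟨T.card, u, fun i j hij => ?_, ?_, fun j _ =>
    ⟨{p | ∃ i, i < j ∧ u i ≤ u j + Finsupp.single p 1}, ?_⟩⟩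
  · refine o.injective (Subtype.ext ?_)
    rw [← hu, ← hu, hij]
  · rw [minGens_span_of_degree_eq hA]
    exact Set.Subset.antisymm (Set.range_subset_iff.2 huA) hrange
  have himage : (fun i => monomial (u i) (1 : K)) '' {i | i < j} =
      (fun a => monomial a (1 : K)) '' (u '' {i | i < j}) := by
    rw [Set.image_image]
  ext s
  rw [Ideal.mem_colon_span_singleton, himage, mem_ideal_span_monomial_image,
    mem_ideal_span_X_image]
  constructor
  · intro hs e he
    obtain ⟨_, ⟨i, hij, rfl⟩, hi⟩ := hs (e + u j) (by
      rw [mem_support_iff, coeff_mul_monomial, mul_one]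
      exact mem_support_iff.1 he)
    obtain ⟨c, hc, hcj, p, hp, hcp⟩ := h _ (huA i) _ (huA j) ((hlt i j).2 hij)
    obtain ⟨i', rfl⟩ := hrange c hc
    refine ⟨p, ⟨i', (hlt i' j).1 hcj, hcp⟩, ?_⟩
    have := hi p
    rw [Finsupp.add_apply] at this
    omega
  · intro hs e he
    rw [mem_support_iff, coeff_mul_monomial'] at he
    split_ifs at he with hje
    · obtain ⟨p, ⟨i, hij, hi⟩, hp⟩ := hs (e - u j) (mem_support_iff.2 (by simpa using he))
      refine ⟨u i, ⟨i, hij, rfl⟩, hi.trans ?_⟩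
      rw [← add_tsub_cancel_of_le hje]
      gcongr
      rw [Finsupp.single_le_iff]
      omega
    · exact absurd rfl he

/-- The key of an exponent vector for the reverse of the lexicographic order along the ordering
`pos` of the variables. -/
def revLexKey (pos : Equiv.Perm (Fin n)) (a : Fin n →₀ ℕ) : (Lex (Fin n → ℕ))ᵒᵈ :=
  OrderDual.toDual (toLex fun t => a (pos.symm t))

theorem revLexKey_injective (pos : Equiv.Perm (Fin n)) : Function.Injective (revLexKey pos) := by
  intro a b hab
  ext i
  simpa using congrFun (toLex.injective (OrderDual.toDual.injective hab)) (pos i)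

theorem revLexKey_lt_iff {pos : Equiv.Perm (Fin n)} {a b : Fin n →₀ ℕ} :
    revLexKey pos a < revLexKey pos b ↔ ∃ p, (∀ x, pos x < pos p → b x = a x) ∧ b p < a p := by
  have h : revLexKey pos a < revLexKey pos b ↔
      ∃ t, (∀ s, s < t → b (pos.symm s) = a (pos.symm s)) ∧ b (pos.symm t) < a (pos.symm t) :=
    Iff.rfl
  rw [h]
  constructor
  · rintro ⟨t, ht, hlt⟩
    exact ⟨pos.symm t, fun x hx => by simpa using ht (pos x) (by simpa using hx), hlt⟩
  · rintro ⟨p, hp, hlt⟩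
    exact ⟨pos p, fun s hs => hp _ (by simpa using hs), by simpa using hlt⟩

/-- If all edges of `G` lie in one connected component, every power of `I_c(G)` has linear
quotients. The generators are ordered lexicographically, along an ordering of the vertices by
decreasing distance from a vertex `r` of that component. -/
theorem hasLinearQuotients_complementaryEdgeIdeal_pow {r : Fin n}
    (hr : ∀ v, (∃ u, G.Adj v u) → G.Reachable v r) (k : ℕ) :
    HasLinearQuotients (complementaryEdgeIdeal K G ^ k) := by
  rw [complementaryEdgeIdeal_pow_eq_span]
  obtain ⟨pos, hpos⟩ := exists_ordering hr
  have hfin : (powExponents G k).Finite := by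
    refine (Set.finite_Iic (constExp n k)).subset ?_
    rintro a ⟨δ, -, h⟩
    exact Set.mem_Iic.2 (h ▸ le_self_add)
  refine hasLinearQuotients_of_order (fun a => degree_of_mem_powExponents) hfin
    (revLexKey_injective pos) ?_
  rintro a ⟨δ', hδ', ha⟩ b ⟨δ, hδ, hb⟩ hab
  obtain ⟨p, hp, hbp⟩ := revLexKey_lt_iff.1 hab
  have hax : ∀ x, a x + δ' x = k := fun x => DFunLike.congr_fun ha x
  have hbx : ∀ x, b x + δ x = k := fun x => DFunLike.congr_fun hb x
  obtain ⟨q, α, hpq, rfl, hα⟩ := hδ.exchange_of_ordering (pos := pos) pos.injective hpos hδ'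
    (b := p) (by have := hax p; have := hbx p; omega) fun x hx => by
      have := hp x hx
      have := hax x
      have := hbx x
      omega
  obtain ⟨c, hc⟩ := hα.exists_compl
  have hcb : c + Finsupp.single q 1 = b + Finsupp.single p 1 := by
    refine add_right_cancel (b := α) ?_
    rw [add_assoc, add_comm _ α, hc, ← hb]
    abel
  have hqp : q ≠ p := by
    rintro rfl
    exact lt_irrefl _ hpq
  refine ⟨c, ⟨_, hα, hc⟩, revLexKey_lt_iff.2 ⟨p, fun x hx => ?_, ?_⟩, p, hbp, hcb ▸ le_self_add⟩
  · have hxp : p ≠ x := by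
      rintro rfl
      exact lt_irrefl _ hx
    have hxq : q ≠ x := by
      rintro rfl
      exact lt_asymm hx hpq
    simpa [Finsupp.single_apply, hxp, hxq, eq_comm] using DFunLike.congr_fun hcb x
  · have := DFunLike.congr_fun hcb p
    simp [hqp] at this
    omega

end Powers

/-! ### The graph of a squarefree monomial ideal generated in degree `n - 2` -/

section Graph

variable {n : ℕ} {K : Type*} [Field K]

theorem minGens_complementaryEdgeIdeal (G : SimpleGraph (Fin n)) :
    minGens (complementaryEdgeIdeal K G) = powExponents G 1 := by
  rw [complementaryEdgeIdeal_eq_span]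
  exact minGens_span_of_degree_eq fun a => degree_of_mem_powExponents

theorem IsMonomial.eq_span_minGens {I : Ideal (MvPolynomial (Fin n) K)} (hI : IsMonomial I) :
    I = Ideal.span ((fun a => monomial a (1 : K)) '' minGens I) := by
  obtain ⟨A, hA⟩ := hI
  apply le_antisymm
  · conv_lhs => rw [hA]
    refine Ideal.span_le.2 ?_
    rintro _ ⟨a, ha, rfl⟩
    have haI : monomial a (1 : K) ∈ I := hA ▸ Ideal.subset_span ⟨a, ha, rfl⟩
    obtain ⟨b, hba, hb⟩ := exists_minimal_le_of_wellFoundedLT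
      (fun b : Fin n →₀ ℕ => monomial b (1 : K) ∈ I) a haI
    refine Ideal.mem_of_dvd _ ?_ (Ideal.subset_span ⟨b, hb, rfl⟩)
    exact ⟨monomial (a - b) 1, by simp [monomial_mul, add_tsub_cancel_of_le hba]⟩
  · refine Ideal.span_le.2 ?_
    rintro _ ⟨a, ha, rfl⟩
    exact ha.1

theorem single_add_single_eq {V : Type*} {u v u' v' : V} (huv : u ≠ v)
    (h : Finsupp.single u 1 + Finsupp.single v 1 =
      (Finsupp.single u' 1 + Finsupp.single v' 1 : V →₀ ℕ)) : s(u, v) = s(u', v') := by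
  classical
  by_cases h1 : u' = u
  · subst h1
    rw [Finsupp.single_left_inj one_ne_zero |>.1 (add_left_cancel h)]
  · have hu := DFunLike.congr_fun h u
    by_cases h2 : v' = u
    · subst h2
      rw [add_comm (Finsupp.single u' 1)] at h
      rw [Finsupp.single_left_inj one_ne_zero |>.1 (add_left_cancel h), Sym2.eq_swap]
    · simp [h1, h2, huv] at hu

theorem complementaryEdgeIdeal_injective :
    Function.Injective (complementaryEdgeIdeal (n := n) K) := by
  have hle : ∀ G G' : SimpleGraph (Fin n),
      complementaryEdgeIdeal K G = complementaryEdgeIdeal K G' → G ≤ G' := by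
    intro G G' h u v huv
    obtain ⟨a, ha⟩ := (IsEdgeSum.zero.add_edge huv).exists_compl
    have hmem : a ∈ powExponents G' 1 := by
      rw [← minGens_complementaryEdgeIdeal (K := K), ← h, minGens_complementaryEdgeIdeal]
      exact ⟨_, IsEdgeSum.zero.add_edge huv, ha⟩
    obtain ⟨u', v', huv', ha'⟩ := mem_powExponents_one.1 hmem
    rw [← ha, zero_add, add_assoc] at ha'
    have := single_add_single_eq huv.ne (add_left_cancel ha').symm
    rw [← SimpleGraph.mem_edgeSet, this]
    exact huv'
  exact fun G G' h => le_antisymm (hle G G' h) (hle G' G h.symm)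

/-- A squarefree exponent vector of degree `n - 2` is the complement of a pair of vertices. -/
theorem exists_add_single_add_single_eq (hn : 2 ≤ n) {a : Fin n →₀ ℕ} (ha : ∀ i, a i ≤ 1)
    (hd : a.degree = n - 2) :
    ∃ u v, u ≠ v ∧ a + Finsupp.single u 1 + Finsupp.single v 1 = constExp n 1 := by
  have hle : a ≤ constExp n 1 := Finsupp.le_def.2 ha
  obtain ⟨δ, hδ⟩ := exists_add_of_le hle
  have hdeg := congrArg Finsupp.degree hδ
  rw [degree_constExp, map_add, hd] at hdeg
  have hδ0 : δ ≠ 0 := by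
    rintro rfl
    simp at hdeg
    omega
  obtain ⟨u, hu⟩ := Finsupp.ne_iff.1 hδ0
  obtain ⟨ε, rfl⟩ := exists_add_of_le (Finsupp.single_le_iff.2 (Nat.one_le_iff_ne_zero.2 hu))
  have hε : ε.degree = 1 := by
    rw [map_add, Finsupp.degree_single] at hdeg
    omega
  obtain ⟨v, rfl⟩ := Finsupp.range_single_one.ge hε
  refine ⟨u, v, ?_, by rw [hδ, add_assoc]⟩
  rintro rfl
  have := DFunLike.congr_fun hδ u
  simp at this

theorem exists_eq_complementaryEdgeIdeal (hn : 2 ≤ n) {I : Ideal (MvPolynomial (Fin n) K)}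
    (hI : IsSquarefreeMonomial I) (hdeg : IsGeneratedInDegree I (n - 2)) :
    ∃ G : SimpleGraph (Fin n), I = complementaryEdgeIdeal K G := by
  refine ⟨{ Adj := fun u v => u ≠ v ∧
              ∃ a ∈ minGens I, a + Finsupp.single u 1 + Finsupp.single v 1 = constExp n 1
            symm := ⟨fun u v ⟨huv, a, ha, h⟩ => ⟨huv.symm, a, ha, by rw [← h, add_right_comm]⟩⟩
            loopless := ⟨fun u h => h.1 rfl⟩ }, ?_⟩
  rw [complementaryEdgeIdeal_eq_span, hI.1.eq_span_minGens]
  congr 2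
  rw [← hI.1.eq_span_minGens]
  ext a
  rw [mem_powExponents_one]
  constructor
  · intro ha
    obtain ⟨u, v, huv, h⟩ := exists_add_single_add_single_eq hn (hI.2 a ha) (hdeg a ha)
    exact ⟨u, v, ⟨huv, a, ha, h⟩, h⟩
  · rintro ⟨u, v, ⟨-, b, hb, hbuv⟩, h⟩
    rw [← h, add_assoc, add_assoc] at hbuv
    exact add_right_cancel hbuv ▸ hb

end Graph

/-! ### Linear relations force one nontrivial component -/

section Components

variable {n : ℕ} {K : Type*} [Field K]

local notation "S" => MvPolynomial (Fin n) K

theorem homogeneousComponent_mem_span_monomial {A : Set (Fin n →₀ ℕ)} {p : S}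
    (hp : p ∈ Ideal.span ((fun a => monomial a (1 : K)) '' A)) (d : ℕ) :
    homogeneousComponent d p ∈ Ideal.span ((fun a => monomial a (1 : K)) '' A) := by
  rw [mem_ideal_span_monomial_image] at hp ⊢
  intro e he
  refine hp e ?_
  rw [mem_support_iff, coeff_homogeneousComponent] at he
  rw [mem_support_iff]
  exact fun h => he (by simp [h])

/-- Let `I = J + J'` be a sum of ideals generated by monomials of degree `N`, with exponents in `B`
and `B'` respectively, such that any common multiple of monomials of `J` and `J'` is a
multiple of a monomial `x^w` of degree at least `N + 2`. If `x^w` is itself such a common multiple,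
then `I` has no linear resolution: if `f_j = g_j + g'_j` are the generators with `g_j ∈ J` and
`g'_j ∈ J'`, then `a ↦ ∑ a_j g_j` maps syzygies to multiples of `x^w`, so it kills the linear ones
by degree reasons, but not the syzygy that comes from two monomials with least common multiple
`x^w`. -/
theorem not_hasLinearResolution_of_sup {B B' : Set (Fin n →₀ ℕ)} {N : ℕ} {w : Fin n →₀ ℕ}
    (hw : N + 2 ≤ w.degree) (hBB' : ∀ b ∈ B, ∀ b' ∈ B', ∀ e, b ≤ e → b' ≤ e → w ≤ e)
    (hB : ∀ b ∈ B, b.degree = N) (hB' : ∀ b ∈ B', b.degree = N) {b b' : Fin n →₀ ℕ}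
    (hb : b ∈ B) (hb' : b' ∈ B') (hbw : b ≤ w) (hb'w : b' ≤ w) :
    ¬ HasLinearResolution (Ideal.span ((fun a => monomial a (1 : K)) '' (B ∪ B'))) := by
  classical
  rintro ⟨d, F, hF⟩
  have hbN := hB b hb
  have hbne : b ≠ w := by
    rintro rfl
    omega
  have hb'ne : b' ≠ w := by
    rintro rfl
    have := hB' b' hb'
    omega
  set J : Ideal S := Ideal.span ((fun a => monomial a (1 : K)) '' B) with hJ
  set J' : Ideal S := Ideal.span ((fun a => monomial a (1 : K)) '' B') with hJ'
  have hsup : Ideal.span ((fun a => monomial a (1 : K)) '' (B ∪ B')) = J ⊔ J' := by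
    rw [Set.image_union, Ideal.span_union]
  have hinf : ∀ p : S, p ∈ J → p ∈ J' → ∀ e ∈ p.support, w ≤ e := by
    intro p hp hp' e he
    rw [hJ, mem_ideal_span_monomial_image] at hp
    rw [hJ', mem_ideal_span_monomial_image] at hp'
    obtain ⟨c, hc, hce⟩ := hp e he
    obtain ⟨c', hc', hce'⟩ := hp' e he
    exact hBB' c hc c' hc' e hce hce'
  -- Each generator splits into a part in `J` and a part in `J'`, both homogeneous of degree `d`.
  have hsplit : ∀ j, ∃ g ∈ J, g.IsHomogeneous d ∧ F.aug j - g ∈ J' := fun j => by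
    have hj : F.aug j ∈ J ⊔ J' := by
      rw [← hsup]
      exact F.span_aug.le (Ideal.subset_span ⟨j, rfl⟩)
    obtain ⟨g, hg, g', hg', h⟩ := Submodule.mem_sup.1 hj
    refine ⟨homogeneousComponent d g, homogeneousComponent_mem_span_monomial hg d,
      homogeneousComponent_isHomogeneous d g, ?_⟩
    have hd : (F.aug j).IsHomogeneous d := by
      have := F.aug_homogeneous j
      rwa [hF] at this
    have h2 : F.aug j = homogeneousComponent d g + homogeneousComponent d g' := by
      rw [← map_add, h, homogeneousComponent_eq_self hd]
    rw [h2, add_sub_cancel_left]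
    exact homogeneousComponent_mem_span_monomial hg' d
  choose g hgJ hgd hgJ' using hsplit
  set ψ := Fintype.linearCombination S g with hψ
  set φ := Fintype.linearCombination S F.aug with hφ
  have hψJ : ∀ a, ψ a ∈ J := fun a => by
    rw [hψ, Fintype.linearCombination_apply]
    exact Submodule.sum_mem _ fun j _ => J.mul_mem_left _ (hgJ j)
  have hφψ : ∀ a, φ a - ψ a ∈ J' := fun a => by
    rw [hψ, hφ, Fintype.linearCombination_apply, Fintype.linearCombination_apply,
      ← Finset.sum_sub_distrib]
    refine Submodule.sum_mem _ fun j _ => ?_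
    rw [← smul_sub]
    exact J'.mul_mem_left _ (hgJ' j)
  have hφsurj : ∀ p ∈ J ⊔ J', ∃ a, φ a = p := fun p hp => by
    rw [← hsup, ← F.span_aug] at hp
    rwa [Ideal.span, ← Fintype.range_linearCombination] at hp
  obtain ⟨a, ha⟩ := hφsurj (monomial b 1)
    (Ideal.mem_sup_left (Ideal.subset_span ⟨b, hb, rfl⟩))
  obtain ⟨a', ha'⟩ := hφsurj (monomial b' 1)
    (Ideal.mem_sup_right (Ideal.subset_span ⟨b', hb', rfl⟩))
  -- The generators have degree at most `N`, since `x^b` is a combination of them.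
  have hdN : d ≤ N := by
    by_contra! hlt
    have h1 : homogeneousComponent N (φ a) = 0 := by
      rw [hφ, Fintype.linearCombination_apply, map_sum]
      refine Finset.sum_eq_zero fun j _ => ?_
      ext e
      rw [coeff_homogeneousComponent, coeff_zero]
      split_ifs with he
      · rw [smul_eq_mul, coeff_mul]
        refine Finset.sum_eq_zero fun x hx => ?_
        have hx' := congrArg Finsupp.degree (Finset.HasAntidiagonal.mem_antidiagonal.1 hx)
        rw [map_add, he] at hx'
        have := F.aug_homogeneous j
        rw [hF] at this
        rw [this.coeff_eq_zero (by omega), mul_zero]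
      · rfl
    rw [ha, homogeneousComponent_eq_self (isHomogeneous_monomial _ hbN)] at h1
    exact one_ne_zero (monomial_eq_zero.1 h1)
  -- The columns of `F.diff 0`, which span all syzygies, are linear; `ψ` maps them to forms of
  -- degree `d + 1` in `J ∩ J'`, where all nonzero elements have degree at least `N + 2`.
  have hψ0 : ∀ s, φ s = 0 → ψ s = 0 := by
    intro s hs
    obtain ⟨t, rfl⟩ := (F.exact_zero s).1 hs
    have hle : LinearMap.range (F.diff 0).mulVecLin ≤ LinearMap.ker ψ := by
      rw [Matrix.range_mulVecLin]
      refine Submodule.span_le.2 ?_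
      rintro _ ⟨c, rfl⟩
      have hker : φ ((F.diff 0).col c) = 0 :=
        (F.exact_zero _).2 ⟨Pi.single c 1, by simp⟩
      have hhom : (ψ ((F.diff 0).col c)).IsHomogeneous (1 + d) := by
        rw [hψ, Fintype.linearCombination_apply]
        refine IsHomogeneous.sum _ _ _ fun j _ => ?_
        refine IsHomogeneous.mul ?_ (hgd j)
        rw [Matrix.col_apply]
        by_cases h0 : F.diff 0 j c = 0
        · rw [h0]
          exact isHomogeneous_zero _ _ _
        · obtain ⟨e, he, hom⟩ := F.diff_homogeneous 0 j c h0
          rw [hF, hF] at he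
          obtain rfl : e = 1 := by omega
          exact hom
      have hJJ' := hφψ ((F.diff 0).col c)
      rw [hker, zero_sub, neg_mem_iff] at hJJ'
      by_contra hne
      obtain ⟨e, he⟩ := support_nonempty.2 hne
      have h1 := Finsupp.degree_mono (hinf _ (hψJ _) hJJ' e he)
      have h2 : e.degree = 1 + d := by
        by_contra hcon
        exact mem_support_iff.1 he (hhom.coeff_eq_zero hcon)
      omega
    exact hle ⟨t, rfl⟩
  -- Compare coefficients of `x^w` in `ψ` of the syzygy `x^(w - b) a - x^(w - b') a'`.
  have hsyz := hψ0 ((monomial (w - b) (1 : K) : S) • a - (monomial (w - b') (1 : K) : S) • a') (by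
    rw [map_sub, map_smul, map_smul, ha, ha', smul_eq_mul, smul_eq_mul, monomial_mul, monomial_mul,
      tsub_add_cancel_of_le hbw, tsub_add_cancel_of_le hb'w, sub_self])
  have hcoeff : ∀ {c : Fin n →₀ ℕ} {p : S}, c ≤ w → c ≠ w → p ∈ J → p ∈ J' →
      coeff w (monomial (w - c) (1 : K) * p) = 0 := by
    intro c p hcw hcne hp hp'
    rw [coeff_monomial_mul', if_pos tsub_le_self, tsub_tsub_cancel_of_le hcw, one_mul]
    by_contra h0
    exact hcne (le_antisymm hcw (hinf p hp hp' c (mem_support_iff.2 h0)))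
  have h1 : ψ a - monomial b 1 ∈ J ∧ ψ a - monomial b 1 ∈ J' := by
    refine ⟨J.sub_mem (hψJ a) (Ideal.subset_span ⟨b, hb, rfl⟩), ?_⟩
    have := hφψ a
    rwa [ha, ← neg_mem_iff, neg_sub] at this
  have h2 : ψ a' ∈ J' := by
    have := J'.sub_mem (Ideal.subset_span ⟨b', hb', rfl⟩) (hφψ a')
    rwa [ha', sub_sub_cancel] at this
  have hdecomp : ψ ((monomial (w - b) (1 : K) : S) • a - (monomial (w - b') (1 : K) : S) • a') =
      monomial w 1 + monomial (w - b) 1 * (ψ a - monomial b 1) - monomial (w - b') 1 * ψ a' := by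
    rw [map_sub, map_smul, map_smul, smul_eq_mul, smul_eq_mul, mul_sub, monomial_mul,
      tsub_add_cancel_of_le hbw, mul_one]
    ring
  rw [hdecomp] at hsyz
  have := congrArg (coeff w) hsyz
  rw [coeff_sub, coeff_add, hcoeff hbw hbne h1.1 h1.2, hcoeff hb'w hb'ne (hψJ a') h2] at this
  simp at this

/-- If `I_c(G)` has a linear resolution, then any two edges of `G` lie in the same connected
component. -/
theorem reachable_of_hasLinearResolution {G : SimpleGraph (Fin n)}
    (h : HasLinearResolution (complementaryEdgeIdeal K G)) {u v u' v' : Fin n}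
    (huv : G.Adj u v) (huv' : G.Adj u' v') : G.Reachable u u' := by
  classical
  by_contra hcon
  set A : Set (Fin n) → Set (Fin n →₀ ℕ) := fun P => {a | ∃ x y, G.Adj x y ∧ x ∈ P ∧
    a + Finsupp.single x 1 + Finsupp.single y 1 = constExp n 1} with hA
  set P : Set (Fin n) := {x | G.Reachable u x} with hP
  have hunion : powExponents G 1 = A P ∪ A Pᶜ := by
    ext a
    rw [mem_powExponents_one]
    constructor
    · rintro ⟨x, y, hxy, h⟩
      by_cases hx : x ∈ P
      · exact Or.inl ⟨x, y, hxy, hx, h⟩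
      · exact Or.inr ⟨x, y, hxy, hx, h⟩
    · rintro (⟨x, y, hxy, -, h⟩ | ⟨x, y, hxy, -, h⟩) <;> exact ⟨x, y, hxy, h⟩
  have hex : ∀ {Q : Set (Fin n)} {x y : Fin n}, G.Adj x y → x ∈ Q →
      ∃ a ∈ A Q, a + Finsupp.single x 1 + Finsupp.single y 1 = constExp n 1 := by
    intro Q x y hxy hx
    obtain ⟨a, ha⟩ := (IsEdgeSum.zero.add_edge hxy).exists_compl
    rw [zero_add, ← add_assoc] at ha
    exact ⟨a, ⟨x, y, hxy, hx, ha⟩, ha⟩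
  obtain ⟨b, hb, hbuv⟩ := hex (Q := P) huv (SimpleGraph.Reachable.refl u)
  obtain ⟨b', hb', hbuv'⟩ := hex (Q := Pᶜ) huv' hcon
  have hle : ∀ {a : Fin n →₀ ℕ} {x y : Fin n},
      a + Finsupp.single x 1 + Finsupp.single y 1 = constExp n 1 →
      a ≤ constExp n 1 ∧ a.degree + 2 = n := by
    intro a x y h
    refine ⟨h ▸ le_self_add.trans le_self_add, ?_⟩
    have := congrArg Finsupp.degree h
    simp [degree_constExp] at this
    omega
  have hdeg : ∀ {Q : Set (Fin n)}, ∀ a ∈ A Q, a.degree = n - 2 := by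
    rintro Q a ⟨x, y, -, -, h⟩
    have := (hle h).2
    omega
  rw [complementaryEdgeIdeal_eq_span, hunion] at h
  refine not_hasLinearResolution_of_sup (N := n - 2) (w := constExp n 1) ?_ ?_ hdeg hdeg hb hb'
    (hle hbuv).1 (hle hbuv').1 h
  · have := (hle hbuv).2
    rw [degree_constExp]
    omega
  · -- An edge inside `P` and one outside are disjoint.
    rintro a ⟨x, y, hxy, hx, h⟩ a' ⟨x', y', hxy', hx', h'⟩ e hae ha'e
    have hy : y ∈ P := hx.trans hxy.reachable
    have hy' : y' ∉ P := fun hy' => hx' (hy'.trans hxy'.symm.reachable)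
    refine Finsupp.le_def.2 fun i => ?_
    have hi := DFunLike.congr_fun h i
    have hi' := DFunLike.congr_fun h' i
    have h1 := hae i
    have h2 := ha'e i
    simp only [Finsupp.add_apply, Finsupp.single_apply, constExp_apply] at hi hi' ⊢
    by_cases hiP : i ∈ P
    · rw [if_neg (by rintro rfl; exact hx' hiP), if_neg (by rintro rfl; exact hy' hiP)] at hi'
      omega
    · rw [if_neg (by rintro rfl; exact hiP hx), if_neg (by rintro rfl; exact hiP hy)] at hi
      omega

theorem one_lt_ncard_supp_iff {G : SimpleGraph (Fin n)} {v : Fin n} :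
    1 < (G.connectedComponentMk v).supp.ncard ↔ ∃ u, G.Adj v u := by
  rw [Set.one_lt_ncard]
  constructor
  · rintro ⟨x, hx, y, hy, hxy⟩
    obtain ⟨z, hz, hzv⟩ : ∃ z, G.Reachable v z ∧ v ≠ z := by
      by_cases hvx : v = x
      · exact ⟨y, (SimpleGraph.ConnectedComponent.exact hy).symm, hvx ▸ hxy⟩
      · exact ⟨x, (SimpleGraph.ConnectedComponent.exact hx).symm, hvx⟩
    obtain ⟨p⟩ := hz
    cases p with
    | nil => exact absurd rfl hzv
    | cons h _ => exact ⟨_, h⟩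
  · rintro ⟨u, hu⟩
    exact ⟨v, rfl, u, SimpleGraph.ConnectedComponent.sound hu.symm.reachable, hu.ne⟩

/-- `c(G) = 1` means that `G` has an edge and all its edges lie in one connected component. -/
theorem numNontrivialComponents_eq_one_iff {G : SimpleGraph (Fin n)} :
    numNontrivialComponents G = 1 ↔
      ∃ r, (∃ u, G.Adj r u) ∧ ∀ v, (∃ u, G.Adj v u) → G.Reachable v r := by
  unfold numNontrivialComponents
  rw [Set.ncard_eq_one]
  constructor
  · rintro ⟨C, hC⟩
    have hmem : ∀ v, (∃ u, G.Adj v u) ↔ G.connectedComponentMk v = C := fun v => by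
      rw [← one_lt_ncard_supp_iff, ← Set.mem_singleton_iff, ← hC]
      rfl
    obtain ⟨r, rfl⟩ := C.exists_rep
    exact ⟨r, (hmem r).2 rfl, fun v hv => SimpleGraph.ConnectedComponent.exact ((hmem v).1 hv)⟩
  · rintro ⟨r, hr, h⟩
    refine ⟨G.connectedComponentMk r, Set.ext fun C => ?_⟩
    constructor
    · intro hC
      obtain ⟨v, rfl⟩ := C.exists_rep
      exact SimpleGraph.ConnectedComponent.sound (h v (one_lt_ncard_supp_iff.1 hC))
    · rintro rfl
      exact one_lt_ncard_supp_iff.2 hr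

theorem exists_adj_of_complementaryEdgeIdeal_ne_bot {G : SimpleGraph (Fin n)}
    (h : complementaryEdgeIdeal K G ≠ ⊥) : ∃ u v, G.Adj u v := by
  by_contra! hcon
  refine h ?_
  rw [complementaryEdgeIdeal_eq_span, Ideal.span_eq_bot]
  rintro _ ⟨a, ha, rfl⟩
  obtain ⟨u, v, huv, -⟩ := mem_powExponents_one.1 ha
  exact absurd huv (hcon u v)

end Components

end MonomialIdeal

theorem mainTheorem2 {K : Type*} [Field K] {n : ℕ} (hn : 2 ≤ n)
    (I : Ideal (MvPolynomial (Fin n) K)) (hI0 : I ≠ ⊥)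
    (hI : MonomialIdeal.IsSquarefreeMonomial I)
    (hdeg : MonomialIdeal.IsGeneratedInDegree I (n - 2)) :
    (∃! G : SimpleGraph (Fin n), I = MonomialIdeal.complementaryEdgeIdeal K G) ∧
    ∀ G : SimpleGraph (Fin n), I = MonomialIdeal.complementaryEdgeIdeal K G →
      List.TFAE [
        MonomialIdeal.HasLinearResolution I,
        ∀ k : ℕ, 1 ≤ k → MonomialIdeal.HasLinearResolution (I ^ k),
        ∀ k : ℕ, 1 ≤ k → MonomialIdeal.HasLinearQuotients (I ^ k),
        MonomialIdeal.numNontrivialComponents G = 1] := by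
  constructor
  · obtain ⟨G, hG⟩ := MonomialIdeal.exists_eq_complementaryEdgeIdeal hn hI hdeg
    exact ⟨G, hG, fun G' hG' =>
      MonomialIdeal.complementaryEdgeIdeal_injective (hG'.symm.trans hG)⟩
  · rintro G rfl
    tfae_have 1 → 4 := fun h => by
      obtain ⟨u, v, huv⟩ := MonomialIdeal.exists_adj_of_complementaryEdgeIdeal_ne_bot hI0
      exact MonomialIdeal.numNontrivialComponents_eq_one_iff.2 ⟨u, ⟨v, huv⟩, fun x ⟨y, hxy⟩ =>
        MonomialIdeal.reachable_of_hasLinearResolution h hxy huv⟩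
    tfae_have 4 → 3 := fun h k _ => by
      obtain ⟨r, -, hr⟩ := MonomialIdeal.numNontrivialComponents_eq_one_iff.1 h
      exact MonomialIdeal.hasLinearQuotients_complementaryEdgeIdeal_pow hr k
    tfae_have 3 → 2 := fun h k hk =>
      MonomialIdeal.hasLinearResolution_complementaryEdgeIdeal_pow (h k hk)
    tfae_have 2 → 1 := fun h => by simpa using h 1 le_rfl
    tfae_finish
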